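/- **Conventions.** A $k$-graph is a (small) category $\Lambda$ with a functor $d:\Lambda\to\mathbb N^k$ (the degree) such that whenever $d(\lambda)=m+n$ there are unique $\mu,\nu$ with $d(\mu)=m$, $d(\nu)=n$ and $\lambda=\mu\nu$. Morphisms are called paths, $\Lambda^0$ (the paths of degree $0$) is identified with the set of objects, whose elements are called vertices, $r$ and $s$ denote range and source, and $vX=\{\lambda\in X: r(\lambda)=v\}$. Let $\mathrm{MCE}(\mu,\nu)$ be the set of $\lambda$ with $d(\lambda)=d(\mu)\vee d(\nu)$ that are of the form $\lambda=\mu\alpha=\nu\beta$; $\Lambda$ is finitely aligned if all these sets are finite. For a vertex $v$, $v\,\mathrm{FE}(\Lambda)$ is the collection of finite sets $E\subset v\Lambda$ such that every $\mu\in v\Lambda$ satisfies $\mathrm{MCE}(\mu,\lambda)\ne\emptyset$ for some $\lambda\in E$. For $m\in(\mathbb N\cup\{\infty\})^k$ let $\Omega_{k,m}$ be the $k$-graph whose paths are the pairs $(p,q)$ with $p\le q\le m$ in $\mathbb N^k$ (and $q$ finite), with $r(p,q)=p$, $s(p,q)=q$, $d(p,q)=q-p$, $(p,q)(q,t)=(p,t)$.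 For a degree-preserving functor $x:\Omega_{k,m}\to\Lambda$ put $d(x)=m$, $r(x)=x(0)$; for $n\in\mathbb N^k$ with $n\le m$ let $\sigma^n(x):\Omega_{k,m-n}\to\Lambda$ be $\sigma^n(x)(p,q)=x(n+p,n+q)$; for $\lambda\in\Lambda$ with $s(\lambda)=r(x)$ let $\lambda x:\Omega_{k,m+d(\lambda)}\to\Lambda$ be the unique degree-preserving functor with $(\lambda x)(0,d(\lambda))=\lambda$ and $\sigma^{d(\lambda)}(\lambda x)=x$. Let $\partial\Lambda$ be the set of all such $x$ (for all $m$) such that for all $n\in\mathbb N^k$ with $n\le d(x)$ and all $E\in x(n)\,\mathrm{FE}(\Lambda)$ there is $p\in\mathbb N^k$ with $p\le d(x)-n$ and $x(n,n+p)\in E$. Let $\Lambda^{\le\infty}$ be the set of all such $x$ for which there is $n_x\in\mathbb N^k$ with $n_x\le d(x)$ such that, whenever $n\in\mathbb N^k$, $n_x\le n\le d(x)$ and $n_i=d(x)_i$, there is no path of degree $e_i$ (the $i$-th generator of $\mathbb N^k$) with range $x(n)$. **Proposition.** Let $\Lambda$ be a finitely aligned $k$-graph. The following are equivalent: 1. $\Lambda$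 is aperiodic: for all distinct $\alpha,\beta\in\Lambda$ with $s(\alpha)=s(\beta)$ there is $\tau\in s(\alpha)\Lambda$ with $\mathrm{MCE}(\alpha\tau,\beta\tau)=\emptyset$. 2. $\Lambda$ has no local periodicity: there are no $v\in\Lambda^0$ and distinct $m,n\in\mathbb N^k$ such that every $x\in v(\partial\Lambda)$ satisfies $m\vee n\le d(x)$ and $\sigma^m(x)=\sigma^n(x)$. 3. Condition (A): for each $v\in\Lambda^0$ there is $x\in v(\partial\Lambda)$ such that, for all $m,n\in\mathbb N^k$ with $m,n\le d(x)$, $\sigma^m(x)=\sigma^n(x)$ implies $m=n$. 4. Condition (B): for each $v\in\Lambda^0$ there is $x\in v\Lambda^{\le\infty}$ such that $\lambda x\ne\mu x$ for all distinct $\lambda,\mu\in\Lambda$ with $s(\lambda)=s(\mu)=v$. -/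

import Mathlib

open CategoryTheory

universe v u

/-- A `k`-graph structure on a category `Λ`: a degree functor to `ℕ^k` with the factorisation
property. A morphism `f : X ⟶ Y` is read as a path with range `X` and source `Y`, so that the
product `μν` of two paths with `s(μ) = r(ν)` is `μ ≫ ν` (that is, `Λ` carries the arrows of the
`k`-graph in diagrammatic order). The objects are the vertices. -/
class KGraph (k : outParam ℕ) (Λ : Type u) [Category.{v} Λ] where
  /-- the degree of a path -/
  degree : ∀ {X Y : Λ}, (X ⟶ Y) → (Fin k → ℕ)
  degree_id : ∀ X : Λ, degree (𝟙 X) = 0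
  degree_comp : ∀ {X Y Z : Λ} (f : X ⟶ Y) (g : Y ⟶ Z), degree (f ≫ g) = degree f + degree g
  factorisation : ∀ {X Y : Λ} (f : X ⟶ Y) (m n : Fin k → ℕ), degree f = m + n →
    ∃! q : Σ Z : Λ, (X ⟶ Z) × (Z ⟶ Y),
      degree q.2.1 = m ∧ degree q.2.2 = n ∧ q.2.1 ≫ q.2.2 = f

namespace KGraph

/-- A path of `Λ`, i.e. a morphism together with its range and its source. -/
@[ext]
structure Path (Λ : Type u) [Category.{v} Λ] where
  /-- the range `r(λ)` -/
  range : Λ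
  /-- the source `s(λ)` -/
  source : Λ
  /-- the underlying morphism -/
  hom : range ⟶ source

/-- The path given by a morphism. -/
def path {Λ : Type u} [Category.{v} Λ] {X Y : Λ} (f : X ⟶ Y) : Path Λ := ⟨X, Y, f⟩

/-- `μ` is an initial segment of `l`, i.e. `l = μη` for some path `η`; equivalently
`d(μ) ≤ d(l)` and `l(0, d(μ)) = μ`. -/
def IsInitialSegment {Λ : Type u} [Category.{v} Λ] (μ l : Path Λ) : Prop :=
  ∃ (Z : Λ) (η : μ.source ⟶ Z), l = path (μ.hom ≫ η)

section Basic

variable {k : ℕ} {Λ : Type u} [Category.{v} Λ] [KGraph k Λ]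

/-- The minimal common extensions of two paths. -/
def MCE (μ ν : Path Λ) : Set (Path Λ) :=
  {l | degree l.hom = degree μ.hom ⊔ degree ν.hom ∧ IsInitialSegment μ l ∧ IsInitialSegment ν l}

variable (Λ) in
/-- `Λ` is finitely aligned: all sets of minimal common extensions are finite. -/
def FinitelyAligned : Prop := ∀ μ ν : Path Λ, (MCE μ ν).Finite

/-- The finite exhaustive sets `v FE(Λ)` of paths with range `v`. -/
def FE (v : Λ) : Set (Set (Path Λ)) :=
  {E | E.Finite ∧ (∀ l ∈ E, l.range = v) ∧
    ∀ μ : Path Λ, μ.range = v → ∃ l ∈ E, (MCE μ l).Nonempty}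

variable (Λ) in
/-- Aperiodicity, in terms of finite paths: any two distinct paths `α`, `β` with the same source
have a common extension by a path `τ` such that `MCE(ατ, βτ) = ∅`. -/
def Aperiodic : Prop :=
  ∀ (X X' Y : Λ) (α : X ⟶ Y) (β : X' ⟶ Y), path α ≠ path β →
    ∃ (Z : Λ) (τ : Y ⟶ Z), MCE (path (α ≫ τ)) (path (β ≫ τ)) = ∅

theorem eq_of_comp_eq {X Y Y' Z : Λ} {f : X ⟶ Y} {g : Y ⟶ Z} {f' : X ⟶ Y'} {g' : Y' ⟶ Z}
    (hd : degree f = degree f') (h : f ≫ g = f' ≫ g') :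
    (⟨Y, f, g⟩ : Σ W : Λ, (X ⟶ W) × (W ⟶ Z)) = ⟨Y', f', g'⟩ := by
  have hg : degree g' = degree g := by
    have := congrArg (fun e : X ⟶ Z => degree e) h
    rw [degree_comp, degree_comp, hd] at this
    exact (add_left_cancel this).symm
  exact (factorisation (f ≫ g) (degree f) (degree g) (degree_comp f g)).unique
    ⟨rfl, rfl, rfl⟩ ⟨hd.symm, hg, h.symm⟩

theorem comp_left_cancel {k : ℕ} {Λ : Type u} [Category.{v} Λ] [KGraph k Λ]
    {X Y Z : Λ} (f : X ⟶ Y) {g g' : Y ⟶ Z} (h : f ≫ g = f ≫ g') :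
    g = g' := by
  have := eq_of_comp_eq (f := f) (g := g) (f' := f) (g' := g') rfl h
  simpa using this

theorem path_left_eq {X Y Z X' Y' Z' : Λ} {f : X ⟶ Y} {g : Y ⟶ Z} {f' : X' ⟶ Y'} {g' : Y' ⟶ Z'}
    (hd : degree f = degree f') (h : path (f ≫ g) = path (f' ≫ g')) : path f = path f' := by
  obtain rfl : X = X' := congrArg Path.range h
  obtain rfl : Z = Z' := congrArg Path.source h
  have h' : f ≫ g = f' ≫ g' := by simpa [path] using h
  have := eq_of_comp_eq hd h'
  exact congrArg (fun q : Σ W : Λ, (X ⟶ W) × (W ⟶ Z) => path q.2.1) this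

theorem path_right_eq {k : ℕ} {Λ : Type u} [Category.{v} Λ] [KGraph k Λ]
    {X Y Z X' Y' Z' : Λ} {f : X ⟶ Y} {g : Y ⟶ Z} {f' : X' ⟶ Y'} {g' : Y' ⟶ Z'}
    (hd : path f = path f') (h : path (f ≫ g) = path (f' ≫ g')) : path g = path g' := by
  obtain rfl : X = X' := congrArg Path.range hd
  obtain rfl : Y = Y' := congrArg Path.source hd
  obtain rfl : Z = Z' := congrArg Path.source h
  obtain rfl : f = f' := by simpa [path] using hd
  have h' : f ≫ g = f ≫ g' := by simpa [path] using h
  rw [comp_left_cancel f h']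

theorem path_comp_congr {X Y Z X' Y' Z' : Λ} {f : X ⟶ Y} {g : Y ⟶ Z} {f' : X' ⟶ Y'}
    {g' : Y' ⟶ Z'} (h : path f = path f') (h' : path g = path g') :
    path (f ≫ g) = path (f' ≫ g') := by
  obtain rfl : X = X' := congrArg Path.range h
  obtain rfl : Y = Y' := congrArg Path.source h
  obtain rfl : Z = Z' := congrArg Path.source h'
  obtain rfl : f = f' := by simpa [path] using h
  obtain rfl : g = g' := by simpa [path] using h'
  rfl

theorem path_comp_of_degree_zero {X Y Z : Λ} (f : X ⟶ Y) (g : Y ⟶ Z) (h : degree f = 0) :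
    path (f ≫ g) = path g := by
  have := eq_of_comp_eq (f := 𝟙 X) (g := f ≫ g) (f' := f) (g' := g)
    (by rw [h, degree_id]) (by simp)
  exact congrArg (fun q : Σ W : Λ, (X ⟶ W) × (W ⟶ Z) => path q.2.2) this

theorem exists_head {X Y : Λ} (f : X ⟶ Y) (m : Fin k → ℕ) (hm : m ≤ degree f) :
    ∃ (Z : Λ) (g : X ⟶ Z) (h : Z ⟶ Y), degree g = m ∧ g ≫ h = f := by
  obtain ⟨⟨Z, g, h⟩, ⟨h1, -, h3⟩, -⟩ :=
    factorisation f m (degree f - m) (add_tsub_cancel_of_le hm).symm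
  exact ⟨Z, g, h, h1, h3⟩

end Basic

/-- The vertices of the `k`-graph `Ω_{k,m}`, for `m ∈ (ℕ ∪ {∞})^k`: all `q ∈ ℕ^k` with `q ≤ m`.
There is exactly one path `(p, q)` with range `p` and source `q` if `p ≤ q`, and none otherwise. -/
@[ext]
structure Omega {k : ℕ} (m : Fin k → ℕ∞) where
  /-- the underlying element of `ℕ^k` -/
  val : Fin k → ℕ
  le_deg : ∀ i, (val i : ℕ∞) ≤ m i

namespace Omega

variable {k : ℕ} {m : Fin k → ℕ∞}

instance : PartialOrder (Omega m) := PartialOrder.lift Omega.val fun _ _ h => Omega.ext h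

/-- The vertex `0` of `Ω_{k,m}`. -/
def zero (m : Fin k → ℕ∞) : Omega m := ⟨0, fun i => by simp⟩

theorem zero_le (q : Omega m) : zero m ≤ q := fun i => Nat.zero_le (q.1 i)

/-- `Ω_{k,m}` is a `k`-graph, with `d(p, q) = q - p`. -/
instance : KGraph k (Omega m) where
  degree := fun {p q} _ => q.1 - p.1
  degree_id p := by simp
  degree_comp {p q r} f g := by
    funext i
    have h1 : p.1 i ≤ q.1 i := leOfHom f i
    have h2 : q.1 i ≤ r.1 i := leOfHom g i
    simp only [Pi.sub_apply, Pi.add_apply]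
    omega
  factorisation {p q} f a b h := by
    have hpq : ∀ i, p.1 i ≤ q.1 i := leOfHom f
    have h' : ∀ i, q.1 i - p.1 i = a i + b i := fun i => congrFun h i
    have hle : ∀ i, (p.1 + a) i ≤ q.1 i := fun i => by
      have := h' i; have := hpq i; simp only [Pi.add_apply]; omega
    let z : Omega m := ⟨p.1 + a, fun i => le_trans (by exact_mod_cast hle i) (q.2 i)⟩
    have hz1 : p ≤ z := fun i => Nat.le_add_right (p.1 i) (a i)
    have hz2 : z ≤ q := hle
    refine ⟨⟨z, homOfLE hz1, homOfLE hz2⟩, ⟨?_, ?_, Subsingleton.elim _ _⟩, ?_⟩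
    · funext i
      simp [z]
    · funext i
      have := h' i
      have := hpq i
      simp only [z, Pi.sub_apply, Pi.add_apply]
      omega
    · rintro ⟨w, g, g'⟩ ⟨hw, -, -⟩
      have hwz : w = z := by
        apply Omega.ext
        funext i
        have h1 : p.1 i ≤ w.1 i := leOfHom g i
        have h2 : w.1 i - p.1 i = a i := congrFun hw i
        simp only [z, Pi.add_apply]
        omega
      subst hwz
      exact congrArg _ (Prod.ext (Subsingleton.elim _ _) (Subsingleton.elim _ _))

end Omega

/-- A `k`-graph morphism `x : Ω_{k,m} → Λ` (a degree-preserving functor), for some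
`m ∈ (ℕ ∪ {∞})^k`; `m` is the degree `d(x)`. -/
structure GPath {k : ℕ} (Λ : Type u) [Category.{v} Λ] [KGraph k Λ] where
  /-- the degree `d(x)` -/
  deg : Fin k → ℕ∞
  /-- the underlying functor -/
  functor : Omega deg ⥤ Λ
  degree_map : ∀ {p q : Omega deg} (f : p ⟶ q), degree (functor.map f) = degree f

namespace GPath

variable {k : ℕ} {Λ : Type u} [Category.{v} Λ] [KGraph k Λ]

/-- The vertex `x(n)`, for `n ≤ d(x)`. -/
abbrev vertex (x : GPath Λ) (n : Omega x.deg) : Λ := x.functor.obj n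

/-- The path `x(p, q)`, for `p ≤ q ≤ d(x)`. -/
def segment (x : GPath Λ) {p q : Omega x.deg} (h : p ≤ q) : Path Λ :=
  path (x.functor.map (homOfLE h))

/-- The range `r(x) = x(0)`. -/
abbrev range (x : GPath Λ) : Λ := x.vertex (Omega.zero x.deg)

/-- The order-preserving map `q ↦ n + q` from `{q ≤ m - n}` to `{q ≤ m}`. -/
def shiftIndex {m : Fin k → ℕ∞} (n : Omega m) (q : Omega (fun i => m i - n.1 i)) : Omega m :=
  ⟨n.1 + q.1, fun i => by
    have h1 := n.2 i
    have h2 := q.2 i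
    simp only [Pi.add_apply, Nat.cast_add]
    calc ((n.1 i : ℕ∞) + q.1 i) ≤ n.1 i + (m i - n.1 i) := by gcongr
      _ = m i := add_tsub_cancel_of_le h1⟩

theorem shiftIndex_mono {m : Fin k → ℕ∞} (n : Omega m) : Monotone (shiftIndex n) :=
  fun _ _ h i => Nat.add_le_add_left (h i) _

/-- The shift `σ^n(x)`, of degree `d(x) - n`, for `n ≤ d(x)`: `σ^n(x)(p, q) = x(n + p, n + q)`. -/
def shift (x : GPath Λ) (n : Omega x.deg) : GPath Λ where
  deg := fun i => x.deg i - n.1 i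
  functor := (shiftIndex_mono n).functor ⋙ x.functor
  degree_map {p q} f := by
    rw [Functor.comp_map, x.degree_map]
    funext i
    exact Nat.add_sub_add_left (n.1 i) (q.1 i) (p.1 i)

/-- `y` is the concatenation `lx`: `y(0, d(l)) = l` and `σ^{d(l)}(y) = x`. -/
def IsConcat (l : Path Λ) (x y : GPath Λ) : Prop :=
  ∃ h : ∀ i, (degree l.hom i : ℕ∞) ≤ y.deg i,
    y.segment (Omega.zero_le ⟨degree l.hom, h⟩) = l ∧ y.shift ⟨degree l.hom, h⟩ = x

theorem segment_comp (x : GPath Λ) {p q r : Omega x.deg} (h : p ≤ q) (h' : q ≤ r) :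
    x.segment (h.trans h') =
      path (x.functor.map (homOfLE h) ≫ x.functor.map (homOfLE h')) := by
  rw [← Functor.map_comp]; rfl

theorem degree_head (x : GPath Λ) (q : Omega x.deg) :
    degree (x.functor.map (homOfLE (Omega.zero_le q))) = q.1 := by
  rw [x.degree_map]
  exact tsub_zero q.1

theorem ext_of_initial {x y : GPath Λ} (hd : x.deg = y.deg)
    (h : ∀ (n : Fin k → ℕ) (hx : ∀ i, (n i : ℕ∞) ≤ x.deg i) (hy : ∀ i, (n i : ℕ∞) ≤ y.deg i),
      x.segment (Omega.zero_le ⟨n, hx⟩) = y.segment (Omega.zero_le ⟨n, hy⟩)) : x = y := by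
  obtain ⟨d, F, hF⟩ := x
  obtain ⟨d', G, hG⟩ := y
  obtain rfl : d = d' := hd
  have h0 : ∀ q : Omega d, path (F.map (homOfLE (Omega.zero_le q))) =
      path (G.map (homOfLE (Omega.zero_le q))) := fun q => h q.1 q.2 q.2
  have hFG : F = G := by
    refine Functor.hext (fun q => congrArg Path.source (h0 q)) (fun p q f => ?_)
    have h1 : path (F.map (homOfLE (Omega.zero_le p)) ≫ F.map f) =
        path (G.map (homOfLE (Omega.zero_le p)) ≫ G.map f) := by
      rw [← Functor.map_comp, ← Functor.map_comp]
      exact h0 q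
    have h2 := path_right_eq (h0 p) h1
    simp only [path, Path.mk.injEq] at h2
    exact h2.2.2
  subst hFG
  rfl

/-- The `k`-graph morphism with prescribed initial segments. -/
noncomputable def ofHeads (m : Fin k → ℕ∞) (X : Λ) (obj : Omega m → Λ) (hd : ∀ q, X ⟶ obj q)
    (hdeg : ∀ q, degree (hd q) = q.1)
    (hcomp : ∀ p q : Omega m, p ≤ q → ∃ g : obj p ⟶ obj q, hd p ≫ g = hd q) : GPath Λ where
  deg := m
  functor :=
    { obj := obj
      map := fun {p q} f => (hcomp p q (leOfHom f)).choose
      map_id := fun p => comp_left_cancel (hd p) (by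
        rw [(hcomp p p le_rfl).choose_spec, Category.comp_id])
      map_comp := fun {p q r} f g => comp_left_cancel (hd p) (by
        rw [(hcomp p r (leOfHom (f ≫ g))).choose_spec, ← Category.assoc, (hcomp p q (leOfHom f)).choose_spec,
          (hcomp q r (leOfHom g)).choose_spec]) }
  degree_map {p q} f := by
    have h := congrArg degree (hcomp p q (leOfHom f)).choose_spec
    rw [degree_comp, hdeg, hdeg] at h
    exact (tsub_eq_of_eq_add_rev h.symm).symm

theorem hd_comp_map_ofHeads {m : Fin k → ℕ∞} {X : Λ} {obj : Omega m → Λ} {hd : ∀ q, X ⟶ obj q}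
    (hdeg : ∀ q, degree (hd q) = q.1)
    (hcomp : ∀ p q : Omega m, p ≤ q → ∃ g : obj p ⟶ obj q, hd p ≫ g = hd q)
    {p q : Omega m} (h : p ≤ q) :
    path (hd p ≫ (ofHeads m X obj hd hdeg hcomp).functor.map (homOfLE h)) = path (hd q) :=
  congrArg path (hcomp p q h).choose_spec

theorem segment_ofHeads {m : Fin k → ℕ∞} {X : Λ} {obj : Omega m → Λ} {hd : ∀ q, X ⟶ obj q}
    (hdeg : ∀ q, degree (hd q) = q.1)
    (hcomp : ∀ p q : Omega m, p ≤ q → ∃ g : obj p ⟶ obj q, hd p ≫ g = hd q) (q : Omega m) :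
    (ofHeads m X obj hd hdeg hcomp).segment (Omega.zero_le q) = path (hd q) := by
  rw [← hd_comp_map_ofHeads hdeg hcomp (Omega.zero_le q)]
  exact (path_comp_of_degree_zero _ _ (hdeg _)).symm

theorem exists_concat {X : Λ} (x : GPath Λ) (l : X ⟶ x.range) :
    ∃ y : GPath Λ, IsConcat (path l) x y := by
  set a := degree l with ha
  let m : Fin k → ℕ∞ := fun i => a i + x.deg i
  let t : Omega m → Omega x.deg := fun q => ⟨q.1 - a, fun i => by
    have h := q.2 i
    rw [Pi.sub_apply, ENat.natCast_sub]
    exact tsub_le_iff_left.2 h⟩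
  have ht : Monotone t := fun p q h i => Nat.sub_le_sub_right (h i) _
  let f : ∀ q : Omega m, X ⟶ x.vertex (t q) := fun q =>
    l ≫ x.functor.map (homOfLE (Omega.zero_le (t q)))
  have hf : ∀ q, degree (f q) = a + (q.1 - a) := fun q => by
    rw [degree_comp, x.degree_head]
  have hle : ∀ q : Omega m, q.1 ≤ degree (f q) := fun q => by
    rw [hf q]; exact le_add_tsub
  choose obj hd tl hdeg htl using fun q : Omega m => exists_head (f q) q.1 (hle q)
  have hcomp : ∀ p q : Omega m, p ≤ q → ∃ g : obj p ⟶ obj q, hd p ≫ g = hd q := by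
    intro p q h
    obtain ⟨Z, g, g', hg, hgg⟩ := exists_head (hd q) p.1 ((hdeg q).symm ▸ h)
    have h1 : hd p ≫ (tl p ≫ x.functor.map (homOfLE (ht h))) = g ≫ (g' ≫ tl q) := by
      rw [← Category.assoc, htl p, ← Category.assoc, hgg, htl q, Category.assoc,
        ← Functor.map_comp]
      rfl
    have h2 := path_left_eq ((hdeg p).trans hg.symm) (congrArg path h1)
    obtain rfl : obj p = Z := congrArg Path.source h2
    obtain rfl : hd p = g := by simpa [path] using h2
    exact ⟨g', hgg⟩
  have ham : ∀ i, (a i : ℕ∞) ≤ m i := fun i => le_self_add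
  have hda : path (hd ⟨a, ham⟩) = path l :=
    path_left_eq (hdeg ⟨a, ham⟩) (congrArg path (htl ⟨a, ham⟩))
  refine ⟨ofHeads m X obj hd hdeg hcomp, ham, ?_, ?_⟩
  · exact (segment_ofHeads hdeg hcomp ⟨a, ham⟩).trans hda
  · refine ext_of_initial ?_ ?_
    · funext i
      exact (ENat.addLECancellable_natCast (a i)).add_tsub_cancel_left
    · intro n hx hy
      have hxm : ∀ i, ((a + n) i : ℕ∞) ≤ m i := fun i => by
        simp only [Pi.add_apply, Nat.cast_add, m]
        gcongr
        exact hy i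
      have hn : t ⟨a + n, hxm⟩ = ⟨n, hy⟩ := Omega.ext (add_tsub_cancel_left a n)
      have hle : (⟨a, ham⟩ : Omega m) ≤ ⟨a + n, hxm⟩ := fun i => Nat.le_add_right _ _
      have h1 : path (hd ⟨a + n, hxm⟩) =
          path (l ≫ x.functor.map (homOfLE (Omega.zero_le ⟨n, hy⟩))) := by
        rw [← hn]
        refine path_left_eq (g := tl _) (g' := 𝟙 _) ?_ ?_
        · rw [hdeg]
          exact ((hf _).trans (by simp)).symm
        · rw [htl, Category.comp_id]
      have h2 := (hd_comp_map_ofHeads hdeg hcomp hle).trans h1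
      exact path_right_eq hda h2

theorem IsConcat.unique {l : Path Λ} {x y y' : GPath Λ} (h : IsConcat l x y)
    (h' : IsConcat l x y') : y = y' := by
  obtain ⟨ha, hl, hs⟩ := h
  obtain ⟨ha', hl', hs'⟩ := h'
  have hdeg : y.deg = y'.deg := by
    funext i
    have h1 : y.deg i - degree l.hom i = y'.deg i - degree l.hom i :=
      (congrFun (congrArg GPath.deg hs) i).trans (congrFun (congrArg GPath.deg hs') i).symm
    rw [← add_tsub_cancel_of_le (ha i), ← add_tsub_cancel_of_le (ha' i), h1]
  have key : ∀ (z z' : GPath Λ), z = z' → ∀ (n : Fin k → ℕ)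
      (hx : ∀ i, (n i : ℕ∞) ≤ z.deg i) (hy : ∀ i, (n i : ℕ∞) ≤ z'.deg i),
      z.segment (Omega.zero_le ⟨n, hx⟩) = z'.segment (Omega.zero_le ⟨n, hy⟩) := by
    rintro z _ rfl n hx hy
    rfl
  refine ext_of_initial hdeg fun n hx hy => ?_
  set a := degree l.hom
  let b : Fin k → ℕ := n - a
  have hb : ∀ i, a i + b i = max (a i) (n i) := fun i => by simp only [b, Pi.sub_apply]; omega
  have hN : ∀ i, ((a + b) i : ℕ∞) ≤ y.deg i := fun i => by
    rw [Pi.add_apply, hb i]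
    rcases max_choice (a i) (n i) with h | h <;> rw [h]
    exacts [ha i, hx i]
  have hN' : ∀ i, ((a + b) i : ℕ∞) ≤ y'.deg i := hdeg ▸ hN
  have hab : a ≤ a + b := fun i => Nat.le_add_right _ _
  have hnb : n ≤ a + b := fun i => by rw [Pi.add_apply, hb i]; exact le_max_right _ _
  have hbs : ∀ i, (b i : ℕ∞) ≤ y.deg i - a i := fun i => by
    have := hN i
    rw [Pi.add_apply, Nat.cast_add] at this
    exact (ENat.addLECancellable_natCast (a i)).le_tsub_of_add_le_left this
  have hbs' : ∀ i, (b i : ℕ∞) ≤ y'.deg i - a i := hdeg ▸ hbs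
  have h2 : y.segment (p := ⟨a, ha⟩) (q := ⟨a + b, hN⟩) hab =
      y'.segment (p := ⟨a, ha'⟩) (q := ⟨a + b, hN'⟩) hab :=
    key _ _ (hs.trans hs'.symm) b hbs hbs'
  have h3 := path_comp_congr (hl.trans hl'.symm) h2
  have h4 := (y.segment_comp (Omega.zero_le ⟨a, ha⟩) (r := ⟨a + b, hN⟩) hab).trans
    (h3.trans (y'.segment_comp (Omega.zero_le ⟨a, ha'⟩) (r := ⟨a + b, hN'⟩) hab).symm)
  have h5 := (y.segment_comp (Omega.zero_le ⟨n, hx⟩) (r := ⟨a + b, hN⟩) hnb).symm.trans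
    (h4.trans (y'.segment_comp (Omega.zero_le ⟨n, hy⟩) (r := ⟨a + b, hN'⟩) hnb))
  exact path_left_eq ((y.degree_head ⟨n, hx⟩).trans (y'.degree_head ⟨n, hy⟩).symm) h5

theorem existsUnique_concat (l : Path Λ) (x : GPath Λ) (h : l.source = x.range) :
    ∃! y : GPath Λ, IsConcat l x y := by
  obtain ⟨X, Y, l⟩ := l
  obtain rfl : Y = x.range := h
  obtain ⟨y, hy⟩ := exists_concat x l
  exact ⟨y, hy, fun y' hy' => IsConcat.unique hy' hy⟩

/-- The concatenation `lx` of a path `l` and a `k`-graph morphism `x : Ω_{k,m} → Λ` with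
`s(l) = r(x)`: the unique `y` with `y(0, d(l)) = l` and `σ^{d(l)}(y) = x`. -/
noncomputable def concat (l : Path Λ) (x : GPath Λ) (h : l.source = x.range) : GPath Λ :=
  (existsUnique_concat l x h).choose

variable (Λ) in
/-- The set `∂Λ`: those `x` such that for all `n ≤ d(x)`, every `E ∈ x(n) FE(Λ)` contains some
`x(n, q)` with `n ≤ q ≤ d(x)`. -/
def boundary : Set (GPath Λ) :=
  {x | ∀ (n : Omega x.deg), ∀ E ∈ FE (x.vertex n), ∃ (q : Omega x.deg) (h : n ≤ q),
    x.segment h ∈ E}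

variable (Λ) in
/-- The set `Λ^{≤∞}`: those `x` for which there is `n_x ∈ ℕ^k` with `n_x ≤ d(x)` such that, for all
`n ∈ ℕ^k` with `n_x ≤ n ≤ d(x)` and all `i` with `n_i = d(x)_i`, no path of degree `e_i` has
range `x(n)`. -/
def leInfinity : Set (GPath Λ) :=
  {x | ∃ nx : Omega x.deg, ∀ n : Omega x.deg, nx ≤ n → ∀ i, (n.1 i : ℕ∞) = x.deg i →
    ∀ (Z : Λ) (e : x.vertex n ⟶ Z), degree e ≠ Pi.single i 1}

end GPath

section Conditions

variable {k : ℕ} {Λ : Type u} [Category.{v} Λ] [KGraph k Λ]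

/-- `Λ` has local periodicity `m, n` at `v`: every `x ∈ v(∂Λ)` satisfies `m ∨ n ≤ d(x)` and
`σ^m(x) = σ^n(x)`. -/
def LocalPeriodicity (m n : Fin k → ℕ) (v : Λ) : Prop :=
  ∀ x ∈ GPath.boundary Λ, x.range = v →
    ∃ (hm : ∀ i, (m i : ℕ∞) ≤ x.deg i) (hn : ∀ i, (n i : ℕ∞) ≤ x.deg i),
      x.shift ⟨m, hm⟩ = x.shift ⟨n, hn⟩

variable (Λ) in
/-- `Λ` has no local periodicity. -/
def NoLocalPeriodicity : Prop :=
  ∀ (v : Λ) (m n : Fin k → ℕ), m ≠ n → ¬ LocalPeriodicity m n v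

variable (Λ) in
/-- Condition (A): every `v` admits `x ∈ v(∂Λ)` such that `σ^m(x) = σ^n(x)` implies `m = n`, for
all `m, n ≤ d(x)`. -/
def ConditionA : Prop :=
  ∀ v : Λ, ∃ x ∈ GPath.boundary Λ, x.range = v ∧
    ∀ m n : Omega x.deg, x.shift m = x.shift n → m = n

variable (Λ) in
/-- Condition (B): every `v` admits `x ∈ v Λ^{≤∞}` such that `lx ≠ μx` for all distinct paths
`l, μ` with source `v`. -/
def ConditionB : Prop :=
  ∀ v : Λ, ∃ x ∈ GPath.leInfinity Λ, x.range = v ∧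
    ∀ (l μ : Path Λ) (hl : l.source = x.range) (hμ : μ.source = x.range), l ≠ μ →
      GPath.concat l x hl ≠ GPath.concat μ x hμ

end Conditions

end KGraph

namespace KGraph

/-! ### Initial segments and degrees of finite paths. -/

section Paths

variable {k : ℕ} {Λ : Type u} [Category.{v} Λ] [KGraph k Λ]

/-! Everything is compared with aperiodicity. If it holds, one path `x` at each vertex serves both
(A) and (B). It is the limit of an increasing sequence of finite paths meeting countably many
requirements: for each `i`, lengthen in direction `i` unless no edge of degree `e_i` is available;
for each pair `m ≠ n`, append a `τ` forcing `σ^m(x) ≠ σ^n(x)`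
(`Aperiodic.exists_extension_shift_ne`). The limit lies in `Λ^{≤∞}`, hence in `∂Λ`
(`boundary_of_leInfinity`), and its shifts are distinct. An equality `lx = μx` would give an
equality of shifts of `x` (`IsConcat.shift_sub_eq`), whence (B); (A) excludes local periodicity at
once.

If aperiodicity fails at `α ≠ β`, all `MCE(ατ, βτ)` are nonempty, and then `αx = βx` for every
boundary path `x` at the common source (`concat_eq_of_MCE_nonempty`). This contradicts (B) directly,
and yields local periodicity with the truncated differences of `d(α)` and `d(β)`. Finite alignment
enters only here: it makes the exhaustive set of `mem_FE_of_MCE_nonempty` finite, and this set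
forces `αx` and `βx` to have the same degree. -/

theorem isInitialSegment_comp {X Y Z : Λ} (f : X ⟶ Y) (g : Y ⟶ Z) :
    IsInitialSegment (path f) (path (f ≫ g)) :=
  ⟨Z, g, rfl⟩

theorem IsInitialSegment.refl (μ : Path Λ) : IsInitialSegment μ μ :=
  ⟨μ.source, 𝟙 _, by rw [Category.comp_id]; rfl⟩

theorem IsInitialSegment.trans {μ ν l : Path Λ} (h : IsInitialSegment μ ν)
    (h' : IsInitialSegment ν l) : IsInitialSegment μ l := by
  obtain ⟨Z, η, rfl⟩ := h
  obtain ⟨W, ζ, rfl⟩ := h'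
  exact ⟨W, η ≫ ζ, congrArg path (Category.assoc _ _ _)⟩

theorem IsInitialSegment.range_eq {μ l : Path Λ} (h : IsInitialSegment μ l) :
    l.range = μ.range := by
  obtain ⟨Z, η, rfl⟩ := h
  rfl

theorem IsInitialSegment.degree_le {μ l : Path Λ} (h : IsInitialSegment μ l) :
    degree μ.hom ≤ degree l.hom := by
  obtain ⟨Z, η, rfl⟩ := h
  exact (degree_comp μ.hom η).symm ▸ le_self_add

theorem IsInitialSegment.of_degree_le {μ ν l : Path Λ} (h : IsInitialSegment μ l)
    (h' : IsInitialSegment ν l) (hd : degree μ.hom ≤ degree ν.hom) : IsInitialSegment μ ν := by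
  obtain ⟨Z, η, rfl⟩ := h
  obtain ⟨W, ζ, h'⟩ := h'
  obtain ⟨V, g, g', hg, hgg⟩ := exists_head ν.hom (degree μ.hom) hd
  rw [← hgg, Category.assoc] at h'
  have h1 : μ = path g := path_left_eq hg.symm h'
  have h2 : ν = path (g ≫ g') := congrArg path hgg.symm
  exact h1 ▸ ⟨_, g', h2⟩

theorem IsInitialSegment.eq_of_degree_eq {μ ν l : Path Λ} (h : IsInitialSegment μ l)
    (h' : IsInitialSegment ν l) (hd : degree μ.hom = degree ν.hom) : μ = ν := by
  obtain ⟨Z, η, rfl⟩ := h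
  obtain ⟨W, ζ, h'⟩ := h'
  exact path_left_eq hd h'

theorem exists_isInitialSegment_degree {l : Path Λ} {n : Fin k → ℕ} (hn : n ≤ degree l.hom) :
    ∃ μ : Path Λ, IsInitialSegment μ l ∧ degree μ.hom = n := by
  obtain ⟨Z, g, h, hg, hgh⟩ := exists_head l.hom n hn
  exact ⟨path g, ⟨l.source, h, congrArg path hgh.symm⟩, hg⟩

/-- Any common extension of two paths extends a minimal one. -/
theorem exists_mem_MCE {μ ν l : Path Λ} (h : IsInitialSegment μ l) (h' : IsInitialSegment ν l) :
    ∃ l' ∈ MCE μ ν, IsInitialSegment l' l := by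
  obtain ⟨l', hl', hd⟩ := exists_isInitialSegment_degree (sup_le h.degree_le h'.degree_le)
  exact ⟨l', ⟨hd, h.of_degree_le hl' (hd ▸ le_sup_left), h'.of_degree_le hl' (hd ▸ le_sup_right)⟩,
    hl'⟩

theorem degree_apply_eq_zero_of_no_edge {X Y : Λ} {i : Fin k}
    (h : ∀ (Z : Λ) (e : X ⟶ Z), degree e ≠ Pi.single i 1) (f : X ⟶ Y) : degree f i = 0 := by
  by_contra h0
  have hle : (Pi.single i 1 : Fin k → ℕ) ≤ degree f := by
    intro j
    rcases eq_or_ne j i with rfl | hj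
    · rw [Pi.single_eq_same]; exact Nat.one_le_iff_ne_zero.2 h0
    · rw [Pi.single_eq_of_ne hj]; exact Nat.zero_le _
  obtain ⟨Z, g, -, hg, -⟩ := exists_head f _ hle
  exact h Z g hg

/-- By factorisation, an edge of degree `e_i` further along could be moved to the front. Once
direction `i` is blocked, it therefore stays blocked. -/
theorem no_edge_of_hom {X Y : Λ} {i : Fin k}
    (h : ∀ (Z : Λ) (e : X ⟶ Z), degree e ≠ Pi.single i 1) (f : X ⟶ Y) (Z : Λ) (e : Y ⟶ Z) :
    degree e ≠ Pi.single i 1 := by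
  intro he
  have := congrFun (degree_comp f e) i
  rw [degree_apply_eq_zero_of_no_edge h, Pi.add_apply, he, Pi.single_eq_same] at this
  omega

end Paths

/-! ### Heads, shifts and concatenations of `k`-graph morphisms. -/

namespace GPath

variable {k : ℕ} {Λ : Type u} [Category.{v} Λ] [KGraph k Λ]

/-- `μ` is an initial segment of `x`, i.e. `d(μ) ≤ d(x)` and `x(0, d(μ)) = μ`. -/
def IsHead (μ : Path Λ) (x : GPath Λ) : Prop :=
  ∃ h : ∀ i, (degree μ.hom i : ℕ∞) ≤ x.deg i, x.segment (Omega.zero_le ⟨degree μ.hom, h⟩) = μ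

theorem segment_congr (x : GPath Λ) {p q p' q' : Omega x.deg} (h : p ≤ q) (h' : p' ≤ q')
    (hp : p.1 = p'.1) (hq : q.1 = q'.1) : x.segment h = x.segment h' := by
  obtain rfl := Omega.ext hp
  obtain rfl := Omega.ext hq
  rfl

theorem isHead_segment (x : GPath Λ) (q : Omega x.deg) : IsHead (x.segment (Omega.zero_le q)) x :=
  ⟨fun i => (congrArg (Nat.cast : ℕ → ℕ∞) (congrFun (x.degree_head q) i)).trans_le (q.2 i),
    x.segment_congr _ _ rfl (x.degree_head q)⟩

theorem exists_isHead (x : GPath Λ) {n : Fin k → ℕ} (hn : ∀ i, (n i : ℕ∞) ≤ x.deg i) :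
    ∃ μ, IsHead μ x ∧ degree μ.hom = n :=
  ⟨_, x.isHead_segment ⟨n, hn⟩, x.degree_head _⟩

theorem isInitialSegment_segment (x : GPath Λ) {p q r : Omega x.deg} (h : p ≤ q) (h' : q ≤ r) :
    IsInitialSegment (x.segment h) (x.segment (h.trans h')) := by
  rw [x.segment_comp h h']
  exact isInitialSegment_comp _ _

theorem IsHead.of_isInitialSegment {μ l : Path Λ} {x : GPath Λ} (h : IsInitialSegment μ l)
    (hl : IsHead l x) : IsHead μ x := by
  obtain ⟨hd, hl⟩ := hl
  have hμ : ∀ i, (degree μ.hom i : ℕ∞) ≤ x.deg i := fun i =>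
    le_trans (by exact_mod_cast h.degree_le i) (hd i)
  refine ⟨hμ, ?_⟩
  have h1 := x.isInitialSegment_segment (Omega.zero_le ⟨degree μ.hom, hμ⟩)
    (r := ⟨degree l.hom, hd⟩) h.degree_le
  rw [hl] at h1
  exact h1.eq_of_degree_eq h (x.degree_head _)

theorem IsHead.isInitialSegment {μ ν : Path Λ} {x : GPath Λ} (h : IsHead μ x) (h' : IsHead ν x)
    (hd : degree μ.hom ≤ degree ν.hom) : IsInitialSegment μ ν := by
  obtain ⟨hμ, h⟩ := h
  obtain ⟨hν, h'⟩ := h'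
  have := x.isInitialSegment_segment (Omega.zero_le ⟨degree μ.hom, hμ⟩)
    (r := ⟨degree ν.hom, hν⟩) hd
  rwa [h, h'] at this

theorem IsHead.eq_of_degree_eq {μ ν : Path Λ} {x : GPath Λ} (h : IsHead μ x) (h' : IsHead ν x)
    (hd : degree μ.hom = degree ν.hom) : μ = ν :=
  (h.isInitialSegment h' hd.le).eq_of_degree_eq (.refl ν) hd

theorem IsHead.range_eq {μ : Path Λ} {x : GPath Λ} (h : IsHead μ x) : μ.range = x.range :=
  (congrArg Path.range h.2).symm

theorem ext_of_isHead {x y : GPath Λ} (hd : x.deg = y.deg)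
    (h : ∀ μ ν, IsHead μ x → IsHead ν y → degree μ.hom = degree ν.hom → μ = ν) : x = y :=
  ext_of_initial hd fun n hx hy => h _ _ (x.isHead_segment _) (y.isHead_segment _)
    ((x.degree_head ⟨n, hx⟩).trans (y.degree_head ⟨n, hy⟩).symm)

theorem MCE_nonempty_of_isHead {μ ν : Path Λ} {x : GPath Λ} (h : IsHead μ x) (h' : IsHead ν x) :
    (MCE μ ν).Nonempty := by
  obtain ⟨l, hl, hd⟩ := x.exists_isHead (n := degree μ.hom ⊔ degree ν.hom) fun i => by
    rw [Pi.sup_apply]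
    rcases max_choice (degree μ.hom i) (degree ν.hom i) with h2 | h2 <;> rw [h2]
    exacts [h.1 i, h'.1 i]
  exact ⟨l, hd, h.isInitialSegment hl (hd ▸ le_sup_left), h'.isInitialSegment hl (hd ▸ le_sup_right)⟩

theorem add_le_deg_of_shift {x : GPath Λ} {n : Omega x.deg} {p : Fin k → ℕ}
    (hp : ∀ i, (p i : ℕ∞) ≤ (x.shift n).deg i) (i : Fin k) : ((n.1 + p) i : ℕ∞) ≤ x.deg i :=
  (shiftIndex n ⟨p, hp⟩).2 i

theorem le_deg_shift {x : GPath Λ} {n : Omega x.deg} {p : Fin k → ℕ}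
    (hp : ∀ i, ((n.1 + p) i : ℕ∞) ≤ x.deg i) (i : Fin k) : (p i : ℕ∞) ≤ (x.shift n).deg i := by
  have := hp i
  rw [Pi.add_apply, Nat.cast_add] at this
  exact (ENat.addLECancellable_natCast (n.1 i)).le_tsub_of_add_le_left this

theorem IsHead.shift {X Y Z : Λ} {a : X ⟶ Y} {f : Y ⟶ Z} {x : GPath Λ}
    (h : IsHead (path (a ≫ f)) x) (n : Omega x.deg) (ha : degree a = n.1) :
    IsHead (path f) (x.shift n) := by
  obtain ⟨n, hn⟩ := n
  obtain rfl : degree a = n := ha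
  have hd : degree (a ≫ f) = degree a + degree f := degree_comp a f
  have hf : ∀ i, ((degree a + degree f) i : ℕ∞) ≤ x.deg i := hd ▸ h.1
  refine ⟨le_deg_shift (n := ⟨degree a, hn⟩) hf, ?_⟩
  have ha' : x.segment (Omega.zero_le ⟨degree a, hn⟩) = path a :=
    (h.of_isInitialSegment (isInitialSegment_comp a f)).2
  have haf : x.segment (Omega.zero_le ⟨degree a + degree f, hf⟩) = path (a ≫ f) :=
    (x.segment_congr _ _ rfl hd.symm).trans h.2
  have hle : (⟨degree a, hn⟩ : Omega x.deg) ≤ ⟨degree a + degree f, hf⟩ :=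
    fun i => Nat.le_add_right _ _
  exact (x.segment_congr (p' := ⟨degree a, hn⟩) (q' := ⟨degree a + degree f, hf⟩) _ hle
    (add_zero _) rfl).trans
    (path_right_eq ha' ((x.segment_comp (Omega.zero_le _) hle).symm.trans haf))

theorem IsConcat.deg_eq {l : Path Λ} {x y : GPath Λ} (h : IsConcat l x y) (i : Fin k) :
    y.deg i = degree l.hom i + x.deg i := by
  obtain ⟨h, -, rfl⟩ := h
  exact (add_tsub_cancel_of_le (h i)).symm

theorem IsConcat.isHead {l : Path Λ} {x y : GPath Λ} (h : IsConcat l x y) : IsHead l y :=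
  ⟨h.1, h.2.1⟩

theorem IsConcat.isHead_comp {X Y Z : Λ} {l : X ⟶ Y} {f : Y ⟶ Z} {x y : GPath Λ}
    (h : IsConcat (path l) x y) (hf : IsHead (path f) x) : IsHead (path (l ≫ f)) y := by
  obtain ⟨hl, hl', rfl⟩ := h
  have hd : ∀ i, ((degree l + degree f) i : ℕ∞) ≤ y.deg i :=
    add_le_deg_of_shift (n := ⟨degree l, hl⟩) hf.1
  have hle : (⟨degree l, hl⟩ : Omega y.deg) ≤ ⟨degree l + degree f, hd⟩ :=
    fun i => Nat.le_add_right _ _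
  have h1 : path (y.functor.map (homOfLE hle)) = path f :=
    (y.segment_congr (q := ⟨degree l + degree f, hd⟩) _ _ (add_zero _).symm rfl).trans hf.2
  have h2 := (y.segment_comp (Omega.zero_le _) hle).trans (path_comp_congr hl' h1)
  rw [← h2]
  exact y.isHead_segment _

theorem shift_shift (x : GPath Λ) (m : Omega x.deg) (n : Omega (x.shift m).deg) :
    (x.shift m).shift n = x.shift (shiftIndex m n) := by
  refine ext_of_initial ?_ fun p hx hy => ?_
  · funext i
    simp [shift, shiftIndex, tsub_tsub]
  · exact x.segment_congr _ _ (add_assoc _ _ _).symm (add_assoc _ _ _).symm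

theorem shift_congr (x : GPath Λ) {m n : Omega x.deg} (h : m.1 = n.1) : x.shift m = x.shift n := by
  rw [Omega.ext h]

/-- Both sides are the same shift of `y`: `σ^p(x) = σ^{a+p}(y) = σ^{b+q}(y) = σ^q(x)`. -/
theorem shift_shift_eq {x y : GPath Λ} {a b : Omega y.deg} (ha : y.shift a = x)
    (hb : y.shift b = x) {p q : Omega x.deg} (h : a.1 + p.1 = b.1 + q.1) :
    x.shift p = x.shift q := by
  have key : ∀ (c : Omega y.deg) (r : Omega x.deg), y.shift c = x →
      ∃ hc, x.shift r = y.shift ⟨c.1 + r.1, hc⟩ := by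
    rintro c r rfl
    exact ⟨_, y.shift_shift c r⟩
  obtain ⟨h1, e1⟩ := key a p ha
  obtain ⟨h2, e2⟩ := key b q hb
  rw [e1, e2]
  exact y.shift_congr h

/-- Turns `lx = μx` into periodicity of `x`. Adding each truncated difference to the other degree
gives `d(l) ∨ d(μ)` both times. The differences fit into `d(x)` because they vanish wherever `d(x)`
is finite. -/
theorem IsConcat.shift_sub_eq {l μ : Path Λ} {x y : GPath Λ} (hl : IsConcat l x y)
    (hμ : IsConcat μ x y) :
    ∃ (h : ∀ i, ((degree l.hom - degree μ.hom) i : ℕ∞) ≤ x.deg i)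
      (h' : ∀ i, ((degree μ.hom - degree l.hom) i : ℕ∞) ≤ x.deg i),
      x.shift ⟨_, h⟩ = x.shift ⟨_, h'⟩ := by
  have key : ∀ i, degree l.hom i = degree μ.hom i ∨ x.deg i = ⊤ := fun i => by
    rcases eq_or_ne (x.deg i) ⊤ with h | h
    · exact .inr h
    · lift x.deg i to ℕ using h with c hc
      have := (hl.deg_eq i).symm.trans (hμ.deg_eq i)
      rw [← hc] at this
      norm_cast at this
      omega
  refine ⟨fun i => ?_, fun i => ?_, ?_⟩
  · rcases key i with h | h <;> simp [h]
  · rcases key i with h | h <;> simp [h]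
  · refine shift_shift_eq (hμ.2.2) (hl.2.2) ?_
    funext i
    simp only [Pi.add_apply, Pi.sub_apply]
    omega

/-! ### Limits of paths, and the inclusion of `Λ^{≤∞}` in `∂Λ`. -/

theorem exists_ge_of_forall_le_iSup {m : ℕ → Fin k → ℕ} (hm : Monotone m) {q : Fin k → ℕ}
    (hq : ∀ i, (q i : ℕ∞) ≤ ⨆ t, (m t i : ℕ∞)) : ∃ t, q ≤ m t := by
  have h : ∀ i, ∃ t, q i ≤ m t i := by
    intro i
    by_contra! h
    rcases Nat.eq_zero_or_pos (q i) with h0 | h0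
    · have := h 0; omega
    · have h1 : ⨆ t, (m t i : ℕ∞) ≤ ((q i - 1 : ℕ) : ℕ∞) :=
        iSup_le fun t => by exact_mod_cast Nat.le_sub_one_of_lt (h t)
      have h2 := (hq i).trans h1
      norm_cast at h2
      omega
  choose t ht using h
  exact ⟨Finset.univ.sup t, fun i => (ht i).trans (hm (Finset.le_sup (Finset.mem_univ i)) i)⟩

/-- An increasing sequence of paths has a limit in the space of `k`-graph morphisms. -/
theorem exists_limit (μ : ℕ → Path Λ) (hμ : ∀ t, IsInitialSegment (μ t) (μ (t + 1))) :
    ∃ x : GPath Λ, (∀ t, IsHead (μ t) x) ∧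
      ∀ q : Omega x.deg, ∃ t, q.1 ≤ degree (μ t).hom := by
  have hmono : ∀ s t, s ≤ t → IsInitialSegment (μ s) (μ t) := fun s t h =>
    Nat.le_induction (.refl _) (fun t _ ih => ih.trans (hμ t)) t h
  have hdm : Monotone fun t => degree (μ t).hom := fun s t h => (hmono s t h).degree_le
  -- With the degree taken as this supremum, every finite `q ≤ m` is already reached at some stage
  -- `t`, and the head of degree `q` is cut from `μ t`.
  let m : Fin k → ℕ∞ := fun i => ⨆ t, (degree (μ t).hom i : ℕ∞)
  have hex : ∀ q : Omega m, ∃ (Z : Λ) (f : (μ 0).range ⟶ Z), degree f = q.1 ∧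
      ∃ t, IsInitialSegment (path f) (μ t) := by
    intro q
    obtain ⟨t, ht⟩ := exists_ge_of_forall_le_iSup hdm q.2
    obtain ⟨ν, hν, hd⟩ := exists_isInitialSegment_degree ht
    have hr : ν.range = (μ 0).range := hν.range_eq.symm.trans (hmono 0 t (Nat.zero_le t)).range_eq
    obtain ⟨X, Z, f⟩ := ν
    obtain rfl : X = (μ 0).range := hr
    exact ⟨Z, f, hd, t, hν⟩
  choose obj hd hdeg T hT using hex
  have hinit : ∀ p q : Omega m, p ≤ q → IsInitialSegment (path (hd p)) (path (hd q)) :=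
    fun p q h => ((hT p).trans (hmono _ _ (le_max_left (T p) (T q)))).of_degree_le
      ((hT q).trans (hmono _ _ (le_max_right (T p) (T q))))
      ((hdeg p).trans_le (le_trans h (hdeg q).ge))
  have hcomp : ∀ p q : Omega m, p ≤ q → ∃ g : obj p ⟶ obj q, hd p ≫ g = hd q := by
    intro p q h
    obtain ⟨Z, g, hg⟩ := hinit p q h
    obtain rfl : obj q = Z := congrArg Path.source hg
    exact ⟨g, by simpa [path] using hg.symm⟩
  refine ⟨ofHeads m _ obj hd hdeg hcomp, fun t => ?_, fun q => ?_⟩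
  · have hle : ∀ i, (degree (μ t).hom i : ℕ∞) ≤ m i := fun i =>
      le_iSup (fun t => (degree (μ t).hom i : ℕ∞)) t
    refine ⟨hle, (segment_ofHeads hdeg hcomp ⟨_, hle⟩).trans ?_⟩
    exact ((hT _).trans (hmono _ _ (le_max_left _ t))).eq_of_degree_eq
      (hmono _ _ (le_max_right _ t)) (hdeg _)
  · exact exists_ge_of_forall_le_iSup hdm q.2

/-- Go so far along `x` that in each direction either no edge is left or all of `E` has been outrun.
An `l ∈ E` with a common extension with this long segment cannot protrude beyond it, so `l` itself
lies on `x`. -/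
theorem boundary_of_leInfinity {x : GPath Λ} (hx : x ∈ leInfinity Λ) : x ∈ boundary Λ := by
  obtain ⟨nx, hnx⟩ := hx
  rintro n E ⟨hfin, hrange, hex⟩
  let N : Fin k → ℕ := fun i => hfin.toFinset.sup fun l => degree l.hom i
  have hp : ∀ i, ∃ c : ℕ, nx.1 i ≤ c ∧ n.1 i ≤ c ∧ (c : ℕ∞) ≤ x.deg i ∧
      ((c : ℕ∞) = x.deg i ∨ n.1 i + N i ≤ c) := by
    intro i
    rcases eq_or_ne (x.deg i) ⊤ with h | h
    · exact ⟨nx.1 i + (n.1 i + N i), by omega, by omega, by simp [h], .inr (by omega)⟩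
    · have h1 := nx.2 i
      have h2 := n.2 i
      lift x.deg i to ℕ using h with c
      exact ⟨c, by exact_mod_cast h1, by exact_mod_cast h2, le_rfl, .inl rfl⟩
  choose p hp1 hp2 hp3 hp4 using hp
  let P : Omega x.deg := ⟨p, hp3⟩
  have hnP : n ≤ P := hp2
  obtain ⟨l, hlE, l', hl'd, ⟨Z, γ, hγ⟩, hl'l⟩ := hex (x.segment hnP) rfl
  have hdP : degree (x.segment hnP).hom = p - n.1 := x.degree_map _
  -- `γ` is the part of the minimal common extension beyond `x(n, P)`. It vanishes in blocked
  -- directions by the choice of `n_x`, and in the others because `l` is no longer than the segment.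
  have hγ0 : ∀ i, degree γ i = 0 := by
    intro i
    rcases hp4 i with h | h
    · exact degree_apply_eq_zero_of_no_edge (hnx P hp1 i h) γ
    · rw [hγ] at hl'd
      have h1 := (congrFun (degree_comp (x.segment hnP).hom γ) i).symm.trans (congrFun hl'd i)
      have h2 : degree l.hom i ≤ N i :=
        Finset.le_sup (f := fun l => degree l.hom i) (hfin.mem_toFinset.2 hlE)
      rw [hdP, Pi.add_apply, Pi.sup_apply, Pi.sub_apply] at h1
      have h3 : max (p i - n.1 i) (degree l.hom i) = p i - n.1 i := max_eq_left (by omega)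
      rw [h3] at h1
      omega
  have hl'd2 : degree l'.hom = p - n.1 := by
    rw [hγ]
    refine (degree_comp _ γ).trans ?_
    exact (congrArg₂ (· + ·) hdP (funext hγ0)).trans (add_zero _)
  have hl'eq : x.segment hnP = l' :=
    IsInitialSegment.eq_of_degree_eq ⟨Z, γ, hγ⟩ (.refl l') (hdP.trans hl'd2.symm)
  have hld : ∀ i, degree l.hom i ≤ p i - n.1 i := fun i =>
    (hl'l.degree_le i).trans_eq (congrFun hl'd2 i)
  have hqp : ∀ i, n.1 i + degree l.hom i ≤ p i := fun i => by
    have := hld i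
    have := hp2 i
    omega
  let q : Omega x.deg := ⟨n.1 + degree l.hom, fun i =>
    le_trans (by exact_mod_cast hqp i) (hp3 i)⟩
  have hnq : n ≤ q := fun i => Nat.le_add_right _ _
  have hqP : q ≤ P := hqp
  refine ⟨q, hnq, ?_⟩
  have h1 := x.isInitialSegment_segment hnq hqP
  rw [hl'eq] at h1
  rw [h1.eq_of_degree_eq hl'l ((x.degree_map _).trans (add_tsub_cancel_left _ _))]
  exact hlE

end GPath

open GPath

/-! ### A path with distinct shifts, built from aperiodicity. -/

section Aperiodicity

variable {k : ℕ} {Λ : Type u} [Category.{v} Λ] [KGraph k Λ]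

/-- Countably many requirements, each of which can be met by extending a given path, can all be met
infinitely often along one increasing sequence of paths. -/
theorem exists_chain {I : Type*} [Countable I] [Nonempty I] (P : I → Path Λ → Path Λ → Prop)
    (hP : ∀ i μ, ∃ l, IsInitialSegment μ l ∧ P i μ l) (v : Λ) :
    ∃ μ : ℕ → Path Λ, (μ 0).range = v ∧ (∀ t, IsInitialSegment (μ t) (μ (t + 1))) ∧
      ∀ i s, ∃ t, s ≤ t ∧ P i (μ t) (μ (t + 1)) := by
  obtain ⟨g, hg⟩ := exists_surjective_nat I
  choose F hF hFP using hP
  -- Step `t` treats the requirement coded by the first component of `t`; as the second component is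
  -- free, each requirement recurs at arbitrarily late stages.
  let μ : ℕ → Path Λ := fun t => Nat.rec (path (𝟙 v)) (fun t l => F (g t.unpair.1) l) t
  refine ⟨μ, rfl, fun t => hF _ _, fun i s => ?_⟩
  obtain ⟨a, rfl⟩ := hg i
  refine ⟨Nat.pair a s, Nat.right_le_pair a s, ?_⟩
  have := hFP (g a) (μ (Nat.pair a s))
  have h2 : μ (Nat.pair a s + 1) = F (g (Nat.pair a s).unpair.1) (μ (Nat.pair a s)) := rfl
  rw [Nat.unpair_pair] at h2
  rwa [h2]

theorem exists_extension_edge (i : Fin k) (μ : Path Λ) :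
    ∃ l, IsInitialSegment μ l ∧ (degree μ.hom i + 1 ≤ degree l.hom i ∨
      ∀ (Z : Λ) (e : l.source ⟶ Z), degree e ≠ Pi.single i 1) := by
  by_cases h : ∃ (Z : Λ) (e : μ.source ⟶ Z), degree e = Pi.single i 1
  · obtain ⟨Z, e, he⟩ := h
    refine ⟨_, isInitialSegment_comp μ.hom e, .inl ?_⟩
    have := congrFun (degree_comp μ.hom e) i
    rw [Pi.add_apply, he, Pi.single_eq_same] at this
    exact this.ge
  · push Not at h
    exact ⟨μ, .refl μ, .inr h⟩

/-- Let `α`, `β` be the tails of `μ` after `m` and `n`. They share a source and differ, as `m ≠ n`.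
Aperiodicity gives `τ` with `MCE(ατ, βτ) = ∅`; were the shifts of some `x` extending `μτ` equal,
`ατ` and `βτ` would both be heads of one path and have a common extension. -/
theorem Aperiodic.exists_extension_shift_ne (hA : Aperiodic Λ) {m n : Fin k → ℕ} (hmn : m ≠ n)
    (μ : Path Λ) :
    ∃ l, IsInitialSegment μ l ∧ (m ≤ degree μ.hom → n ≤ degree μ.hom →
      ∀ x : GPath Λ, IsHead l x → ∀ hm hn, x.shift ⟨m, hm⟩ ≠ x.shift ⟨n, hn⟩) := by
  by_cases h : m ≤ degree μ.hom ∧ n ≤ degree μ.hom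
  · obtain ⟨A, a, α, ha, haα⟩ := exists_head μ.hom m h.1
    obtain ⟨B, b, β, hb, hbβ⟩ := exists_head μ.hom n h.2
    have hne : path α ≠ path β := by
      intro he
      obtain rfl : A = B := congrArg Path.range he
      obtain rfl : α = β := by simpa [path] using he
      have h1 := congrArg degree (haα.trans hbβ.symm)
      rw [degree_comp, degree_comp, ha, hb] at h1
      exact hmn (add_right_cancel h1)
    obtain ⟨Z, τ, hτ⟩ := hA A B _ α β hne
    refine ⟨_, isInitialSegment_comp μ.hom τ, fun _ _ x hx hm hn he => ?_⟩
    have h1 : IsHead (path (α ≫ τ)) (x.shift ⟨m, hm⟩) := by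
      refine IsHead.shift (a := a) ?_ _ ha
      rwa [← Category.assoc, haα]
    have h2 : IsHead (path (β ≫ τ)) (x.shift ⟨m, hm⟩) := by
      rw [he]
      refine IsHead.shift (a := b) ?_ _ hb
      rwa [← Category.assoc, hbβ]
    exact (MCE_nonempty_of_isHead h1 h2).ne_empty hτ
  · exact ⟨μ, .refl μ, fun h1 h2 => absurd ⟨h1, h2⟩ h⟩

/-- In an aperiodic `k`-graph each vertex is the range of an element of `Λ^{≤∞}` all of whose shifts
are distinct. -/
theorem Aperiodic.exists_mem_leInfinity (hA : Aperiodic Λ) (v : Λ) :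
    ∃ x ∈ leInfinity Λ, x.range = v ∧ ∀ m n : Omega x.deg, x.shift m = x.shift n → m = n := by
  let P : Fin k ⊕ (Fin k → ℕ) × (Fin k → ℕ) → Path Λ → Path Λ → Prop := fun c μ l =>
    Sum.elim
      (fun i => degree μ.hom i + 1 ≤ degree l.hom i ∨
        ∀ (Z : Λ) (e : l.source ⟶ Z), degree e ≠ Pi.single i 1)
      (fun c => c.1 ≠ c.2 → c.1 ≤ degree μ.hom → c.2 ≤ degree μ.hom →
        ∀ x : GPath Λ, IsHead l x → ∀ hm hn, x.shift ⟨c.1, hm⟩ ≠ x.shift ⟨c.2, hn⟩) c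
  obtain ⟨μ, hμv, hμ, hμP⟩ := exists_chain P (by
    rintro (i | ⟨m, n⟩) μ
    · exact exists_extension_edge i μ
    · by_cases hmn : m = n
      · exact ⟨μ, .refl μ, fun h => absurd hmn h⟩
      · obtain ⟨l, hl, hl'⟩ := hA.exists_extension_shift_ne hmn μ
        exact ⟨l, hl, fun _ => hl'⟩) v
  have hmono : ∀ s t, s ≤ t → IsInitialSegment (μ s) (μ t) := fun s t h =>
    Nat.le_induction (.refl _) (fun t _ ih => ih.trans (hμ t)) t h
  obtain ⟨x, hx, hxT⟩ := exists_limit μ hμ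
  refine ⟨x, ?_, (hx 0).range_eq.symm.trans hμv, fun m n hmn => ?_⟩
  · have hT : ∀ i, ∃ t, x.deg i = ⊤ ∨
        ∀ (Z : Λ) (e : (μ t).source ⟶ Z), degree e ≠ Pi.single i 1 := by
      intro i
      rcases eq_or_ne (x.deg i) ⊤ with h | h
      · exact ⟨0, .inl h⟩
      · obtain ⟨c, hc⟩ := ENat.ne_top_iff_exists.1 h
        -- At stage `s` the full degree `c` in direction `i` is used up, so at a later treatment of
        -- `i` lengthening is impossible and the direction must be blocked.
        obtain ⟨s, hs⟩ := hxT ⟨Pi.single i c, fun j => by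
          rcases eq_or_ne j i with rfl | hj
          · rw [Pi.single_eq_same, hc]
          · rw [Pi.single_eq_of_ne hj]; simp⟩
        have hs : c ≤ degree (μ s).hom i := by simpa using hs i
        obtain ⟨t, hst, ht⟩ := hμP (.inl i) s
        refine ⟨t + 1, .inr (ht.resolve_left fun h1 => ?_)⟩
        have h1 : degree (μ t).hom i + 1 ≤ degree (μ (t + 1)).hom i := h1
        have h2 := (hx (t + 1)).1 i
        have h3 : degree (μ s).hom i ≤ degree (μ t).hom i := (hmono s t hst).degree_le i
        rw [← hc] at h2
        norm_cast at h2
        omega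
    choose T hT using hT
    obtain ⟨hd, hseg⟩ := hx (Finset.univ.sup T)
    -- `n_x` is the degree at a stage by which all directions with `d(x)_i` finite are blocked.
    refine ⟨⟨_, hd⟩, fun n hn i hni => ?_⟩
    have hne := (hT i).resolve_left (hni ▸ ENat.natCast_ne_top _)
    obtain ⟨Z, η, hη⟩ := hmono (T i) _ (Finset.le_sup (Finset.mem_univ i))
    have hs : x.vertex ⟨_, hd⟩ = Z := (congrArg Path.source hseg).trans (congrArg Path.source hη)
    exact no_edge_of_hom hne (η ≫ eqToHom hs.symm ≫ x.functor.map (homOfLE hn))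
  · by_contra hne
    obtain ⟨s, hs⟩ := hxT m
    obtain ⟨s', hs'⟩ := hxT n
    obtain ⟨t, hst, ht⟩ := hμP (.inr (m.1, n.1)) (max s s')
    exact ht (fun h => hne (Omega.ext h))
      (hs.trans (hmono s t ((le_max_left _ _).trans hst)).degree_le)
      (hs'.trans (hmono s' t ((le_max_right _ _).trans hst)).degree_le) x (hx (t + 1)) m.2 n.2 hmn

/-! ### Consequences of a failure of aperiodicity. -/

/-- The extensions of `α` to minimal common extensions of `α` and `β` form a finite exhaustive set
if all `MCE(ατ, βτ)` are nonempty. -/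
theorem mem_FE_of_MCE_nonempty (hΛ : FinitelyAligned Λ) {X X' Y : Λ} (α : X ⟶ Y) (β : X' ⟶ Y)
    (h : ∀ (Z : Λ) (τ : Y ⟶ Z), (MCE (path (α ≫ τ)) (path (β ≫ τ))).Nonempty) :
    {g | ∃ (W : Λ) (f : Y ⟶ W), g = path f ∧ path (α ≫ f) ∈ MCE (path α) (path β)} ∈ FE Y := by
  refine ⟨?_, ?_, ?_⟩
  -- By left cancellation each minimal common extension is `αf` for at most one `f`.
  · refine ((hΛ (path α) (path β)).biUnion (t := fun l =>
      {g | ∃ (W : Λ) (f : Y ⟶ W), g = path f ∧ path (α ≫ f) = l}) fun l _ =>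
        Set.Subsingleton.finite ?_).subset ?_
    · rintro _ ⟨W, f, rfl, hf⟩ _ ⟨W', f', rfl, hf'⟩
      exact path_right_eq rfl (hf.trans hf'.symm)
    · rintro _ ⟨W, f, rfl, hf⟩
      exact Set.mem_biUnion hf ⟨W, f, rfl, rfl⟩
  · rintro _ ⟨W, f, rfl, -⟩
    rfl
  · rintro ⟨R, Z, τ⟩ hτ
    obtain rfl : R = Y := hτ
    obtain ⟨l, -, hl, hl'⟩ := h Z τ
    -- A common extension of `ατ` and `βτ` also passes through some `αf` in `MCE(α, β)`; cancelling
    -- `α` gives a common extension of `τ` and `f`.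
    obtain ⟨l', hl'mem, hl'l⟩ := exists_mem_MCE ((isInitialSegment_comp α τ).trans hl)
      ((isInitialSegment_comp β τ).trans hl')
    obtain ⟨W, f, hf⟩ := hl'mem.2.1
    obtain ⟨V, ζ, rfl⟩ := hl
    obtain ⟨V', ζ', hζ'⟩ := hl'l
    subst hf
    refine ⟨path f, ⟨W, f, rfl, hl'mem⟩, ?_⟩
    have h1 : path (α ≫ τ ≫ ζ) = path (α ≫ f ≫ ζ') :=
      (congrArg path (Category.assoc α τ ζ)).symm.trans
        (hζ'.trans (congrArg path (Category.assoc α f ζ')))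
    have h2 : path (τ ≫ ζ) = path (f ≫ ζ') := path_right_eq rfl h1
    obtain ⟨l, hl, -⟩ := exists_mem_MCE (isInitialSegment_comp τ ζ)
      (h2 ▸ isInitialSegment_comp f ζ')
    exact ⟨l, hl⟩

/-- With `f = x(0, p)`, the boundary condition at `p` for the exhaustive set of `αf`, `βf` yields a
segment `x(p, q)` of degree `d(α) ∨ d(β) - d(α)`, so `x` has room for it after `p`. -/
theorem add_sub_le_deg_of_MCE_nonempty (hΛ : FinitelyAligned Λ) {x : GPath Λ}
    (hx : x ∈ boundary Λ) {X X' : Λ} (α : X ⟶ x.range) (β : X' ⟶ x.range)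
    (h : ∀ (Z : Λ) (τ : x.range ⟶ Z), (MCE (path (α ≫ τ)) (path (β ≫ τ))).Nonempty)
    (p : Omega x.deg) (i : Fin k) :
    ((p.1 i + (degree β i - degree α i) : ℕ) : ℕ∞) ≤ x.deg i := by
  let f := x.functor.map (homOfLE (Omega.zero_le p))
  obtain ⟨q, hpq, W, g, hg, hgd, -⟩ := hx p _ (mem_FE_of_MCE_nonempty hΛ (α ≫ f) (β ≫ f)
    fun Z τ => by
      rw [Category.assoc, Category.assoc]
      exact h Z (f ≫ τ))
  have h1 : q.1 - p.1 = degree g :=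
    (x.degree_map (homOfLE hpq)).symm.trans (congrArg (fun l : Path Λ => degree l.hom) hg)
  have h2 : degree ((α ≫ f) ≫ g) = degree (α ≫ f) ⊔ degree (β ≫ f) := hgd
  rw [degree_comp, degree_comp, degree_comp, ← h1] at h2
  have h3 := congrFun h2 i
  have h4 := hpq i
  simp only [Pi.add_apply, Pi.sub_apply, Pi.sup_apply] at h3
  have h5 : degree β i + degree f i ≤ degree α i + degree f i + (q.1 i - p.1 i) :=
    le_sup_right.trans_eq h3.symm
  have h6 : p.1 i + (degree β i - degree α i) ≤ q.1 i := by
    have h4 : p.1 i ≤ q.1 i := h4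
    omega
  exact le_trans (by exact_mod_cast h6) (q.2 i)

/-- If `d(x)_i` is finite, take `p_i = d(x)_i` in the preceding bound: no room is left after `p`, so
the excess of `d(β)_i` over `d(α)_i` is zero. -/
theorem degree_le_or_deg_eq_top (hΛ : FinitelyAligned Λ) {x : GPath Λ}
    (hx : x ∈ boundary Λ) {X X' : Λ} (α : X ⟶ x.range) (β : X' ⟶ x.range)
    (h : ∀ (Z : Λ) (τ : x.range ⟶ Z), (MCE (path (α ≫ τ)) (path (β ≫ τ))).Nonempty)
    (i : Fin k) : degree β i ≤ degree α i ∨ x.deg i = ⊤ := by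
  rcases eq_or_ne (x.deg i) ⊤ with ht | ht
  · exact .inr ht
  · obtain ⟨c, hc⟩ := ENat.ne_top_iff_exists.1 ht
    have h1 := add_sub_le_deg_of_MCE_nonempty hΛ hx α β h ⟨Pi.single i c, fun j => by
      rcases eq_or_ne j i with rfl | hj
      · rw [Pi.single_eq_same, hc]
      · rw [Pi.single_eq_of_ne hj]; simp⟩ i
    have h2 : ((c + (degree β i - degree α i) : ℕ) : ℕ∞) ≤ c := by
      rw [hc]
      simpa using h1
    norm_cast at h2
    omega

theorem MCE_comm (μ ν : Path Λ) : MCE μ ν = MCE ν μ := by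
  ext l
  simp only [MCE, Set.mem_ofPred_eq, sup_comm (degree μ.hom), and_comm (a := IsInitialSegment μ l)]

/-- If all `MCE(ατ, βτ)` are nonempty then `αx = βx` for all boundary paths `x`. -/
theorem concat_eq_of_MCE_nonempty (hΛ : FinitelyAligned Λ) {x : GPath Λ}
    (hx : x ∈ boundary Λ) {X X' : Λ} (α : X ⟶ x.range) (β : X' ⟶ x.range)
    (h : ∀ (Z : Λ) (τ : x.range ⟶ Z), (MCE (path (α ≫ τ)) (path (β ≫ τ))).Nonempty)
    {y y' : GPath Λ} (hy : IsConcat (path α) x y) (hy' : IsConcat (path β) x y') : y = y' := by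
  have hαβ := degree_le_or_deg_eq_top hΛ hx α β h
  have hβα := degree_le_or_deg_eq_top hΛ hx β α fun Z τ => MCE_comm (path (α ≫ τ)) _ ▸ h Z τ
  refine ext_of_isHead (funext fun i => ?_) fun μ ν hμ hν hd => ?_
  · rw [hy.deg_eq, hy'.deg_eq]
    rcases hαβ i with h1 | h1
    · rcases hβα i with h2 | h2
      · rw [show degree (path α).hom i = degree (path β).hom i from le_antisymm h2 h1]
      · simp [h2]
    · simp [h1]
  -- `p` is just large enough that, for `f = x(0, p)`, `αf` covers `μ` and `βf` covers `ν`. A common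
  -- extension of `αf` and `βf` then has both `μ` and `ν` as heads of the same degree.
  · let p : Omega x.deg := ⟨fun i => max (degree μ.hom i - degree α i) (degree μ.hom i - degree β i),
      fun i => by
        have h1 := hμ.1 i
        have h2 := hν.1 i
        rw [hy.deg_eq] at h1
        rw [hy'.deg_eq, ← hd] at h2
        rcases max_choice (degree μ.hom i - degree α i) (degree μ.hom i - degree β i) with h3 | h3 <;>
          rw [h3, ENat.natCast_sub]
        exacts [tsub_le_iff_left.2 h1, tsub_le_iff_left.2 h2]⟩
    let f := x.functor.map (homOfLE (Omega.zero_le p))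
    have hf : degree f = p.1 := x.degree_head p
    have hα := hy.isHead_comp (f := f) (x.isHead_segment p)
    have hβ := hy'.isHead_comp (f := f) (x.isHead_segment p)
    obtain ⟨l, -, hl, hl'⟩ := h _ f
    have h1 : IsInitialSegment μ (path (α ≫ f)) := hμ.isInitialSegment hα fun i => by
      have : degree (α ≫ f) i = degree α i + p.1 i := by rw [degree_comp, hf, Pi.add_apply]
      refine le_of_le_of_eq ?_ this.symm
      have := le_max_left (degree μ.hom i - degree α i) (degree μ.hom i - degree β i)
      exact tsub_le_iff_left.1 this
    have h2 : IsInitialSegment ν (path (β ≫ f)) := hν.isInitialSegment hβ fun i => by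
      have : degree (β ≫ f) i = degree β i + p.1 i := by rw [degree_comp, hf, Pi.add_apply]
      refine le_of_le_of_eq ?_ this.symm
      have := le_max_right (degree μ.hom i - degree α i) (degree μ.hom i - degree β i)
      rw [← hd]
      exact tsub_le_iff_left.1 this
    exact (h1.trans hl).eq_of_degree_eq (h2.trans hl') hd

/-! ### The implications between the conditions. -/

theorem Aperiodic.conditionA (hA : Aperiodic Λ) : ConditionA Λ := fun v =>
  let ⟨x, hx, hv, h⟩ := hA.exists_mem_leInfinity v
  ⟨x, boundary_of_leInfinity hx, hv, h⟩

theorem ConditionA.noLocalPeriodicity (hA : ConditionA Λ) : NoLocalPeriodicity Λ := by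
  intro v m n hmn hp
  obtain ⟨x, hx, hv, h⟩ := hA v
  obtain ⟨hm, hn, he⟩ := hp x hx hv
  exact hmn (congrArg Omega.val (h _ _ he))

theorem isConcat_concat (l : Path Λ) (x : GPath Λ) (h : l.source = x.range) :
    IsConcat l x (concat l x h) :=
  (existsUnique_concat l x h).choose_spec.1

theorem Aperiodic.conditionB (hA : Aperiodic Λ) : ConditionB Λ := by
  intro v
  obtain ⟨x, hx, hv, h⟩ := hA.exists_mem_leInfinity v
  refine ⟨x, hx, hv, fun l μ hl hμ hne he => ?_⟩
  have h1 := isConcat_concat l x hl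
  have h2 := isConcat_concat μ x hμ
  rw [← he] at h2
  obtain ⟨hm, hn, hs⟩ := h1.shift_sub_eq h2
  have h3 := congrArg Omega.val (h _ _ hs)
  -- Equal truncated differences force `d(l) = d(μ)`, and a path has only one head of each degree.
  refine hne (h1.isHead.eq_of_degree_eq h2.isHead (funext fun i => ?_))
  have h4 := congrFun h3 i
  simp only [Pi.sub_apply] at h4
  omega

theorem ConditionB.aperiodic (hΛ : FinitelyAligned Λ) (hB : ConditionB Λ) : Aperiodic Λ := by
  intro X X' Y α β hne
  by_contra! h
  obtain ⟨x, hx, rfl, hx'⟩ := hB Y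
  exact hx' (path α) (path β) rfl rfl hne (concat_eq_of_MCE_nonempty hΛ (boundary_of_leInfinity hx)
    α β h (isConcat_concat _ _ _) (isConcat_concat _ _ _))

theorem NoLocalPeriodicity.aperiodic (hΛ : FinitelyAligned Λ) (hP : NoLocalPeriodicity Λ) :
    Aperiodic Λ := by
  intro X X' Y α β hne
  by_contra! h
  refine hP Y (degree α - degree β) (degree β - degree α) (fun hd => hne ?_) ?_
  -- Taking `τ` to be the identity shows that `α` and `β` have a common extension; equal degrees
  -- would make them equal.
  · obtain ⟨l, -, hl, hl'⟩ := h Y (𝟙 Y)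
    rw [Category.comp_id] at hl hl'
    refine hl.eq_of_degree_eq hl' (funext fun i => ?_)
    have h4 := congrFun hd i
    simp only [Pi.sub_apply] at h4
    exact show degree α i = degree β i by omega
  · rintro x hx rfl
    obtain ⟨y, hy⟩ := exists_concat x α
    obtain ⟨y', hy'⟩ := exists_concat x β
    obtain rfl := concat_eq_of_MCE_nonempty hΛ hx α β h hy hy'
    exact hy.shift_sub_eq hy'

end Aperiodicity

end KGraph

theorem proposition3p5 {k : ℕ} (Λ : Type u) [Category.{v} Λ] [KGraph k Λ]
    (hΛ : KGraph.FinitelyAligned Λ) :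
    List.TFAE [KGraph.Aperiodic Λ, KGraph.NoLocalPeriodicity Λ,
      KGraph.ConditionA Λ, KGraph.ConditionB Λ] := by
  tfae_have 1 → 3 := KGraph.Aperiodic.conditionA
  tfae_have 3 → 2 := KGraph.ConditionA.noLocalPeriodicity
  tfae_have 2 → 1 := KGraph.NoLocalPeriodicity.aperiodic hΛ
  tfae_have 1 → 4 := KGraph.Aperiodic.conditionB
  tfae_have 4 → 1 := KGraph.ConditionB.aperiodic hΛ
  tfae_finish
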